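/- Let $G$ be a discrete group and let $\lambda$ be its left regular representation on $\ell^2(G)$, $(\lambda(g)f)(h) = f(g^{-1}h)$. Let $g_1,\dots,g_n \in G$ and let $H$ be the subgroup of $G$ generated by $\{g_1,\dots,g_n\}$. Let $\alpha_1,\dots,\alpha_n > 0$ and put $A = \sum_{i=1}^n \alpha_i \lambda(g_i) \in B(\ell^2(G))$. Then the numerical radius $w(A) = \sup\{ |\langle A h, h\rangle| : h \in \ell^2(G),\ \|h\| = 1 \}$ satisfies $w(A) = \sum_{i=1}^n \alpha_i$ if and only if $H$ is amenable, that is, if and only if there is a left-invariant mean on $\ell^\infty(H)$: a positive linear functional $m$ on $\ell^\infty(H)$ with $m(1) = 1$ and $m(s\cdot f) = m(f)$ for all $s \in H$ and $f \in \ell^\infty(H)$, where $(s\cdot f)(h) = f(s^{-1}h)$. -/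

import Mathlib

open scoped ENNReal lp

noncomputable section

/-- If `f ∈ ℓ^p(G)` then `h ↦ f (g⁻¹ h)` is in `ℓ^p(G)`. -/
theorem memℓp_leftTranslate {G : Type*} [Group G] {𝕜 : Type*} [NormedField 𝕜] {p : ℝ≥0∞}
    (g : G) {f : G → 𝕜} (hf : Memℓp f p) : Memℓp (fun h => f (g⁻¹ * h)) p := by
  rcases p.trichotomy with rfl | rfl | hp
  · refine memℓp_zero ?_
    exact (memℓp_zero_iff.1 hf).preimage ((mul_right_injective g⁻¹).injOn)
  · refine memℓp_infty ?_
    refine (memℓp_infty_iff.1 hf).mono ?_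
    rintro _ ⟨h, rfl⟩
    exact ⟨g⁻¹ * h, rfl⟩
  · refine memℓp_gen ?_
    exact (Equiv.mulLeft g⁻¹).summable_iff.2 ((memℓp_gen_iff hp).1 hf)

/-- Left translation by `g` on `ℓ^p(G)`, `(g · f)(h) = f (g⁻¹ h)`, as a linear map. -/
def leftTranslate {G : Type*} [Group G] (𝕜 : Type*) [NormedField 𝕜] (p : ℝ≥0∞) (g : G) :
    ℓ^p(G, 𝕜) →ₗ[𝕜] ℓ^p(G, 𝕜) where
  toFun f := ⟨fun h => f (g⁻¹ * h), memℓp_leftTranslate g f.2⟩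
  map_add' _ _ := rfl
  map_smul' _ _ := rfl

theorem norm_leftTranslate_two {G : Type*} [Group G] (g : G) (f : ℓ^2(G, ℂ)) :
    ‖leftTranslate ℂ 2 g f‖ = ‖f‖ := by
  have h2 : 0 < (2 : ℝ≥0∞).toReal := by norm_num
  rw [lp.norm_eq_tsum_rpow h2, lp.norm_eq_tsum_rpow h2]
  congr 1
  exact (Equiv.mulLeft g⁻¹).tsum_eq (fun h => ‖f h‖ ^ (2 : ℝ≥0∞).toReal)

/-- The operator `λ(g)` of the left regular representation of the discrete group `G` on the
Hilbert space `ℓ²(G)`: `(λ(g) f)(h) = f (g⁻¹ h)`. -/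
def leftRegular {G : Type*} [Group G] (g : G) : ℓ^2(G, ℂ) →L[ℂ] ℓ^2(G, ℂ) :=
  (LinearIsometry.mk (leftTranslate ℂ 2 g) (norm_leftTranslate_two g)).toContinuousLinearMap

/-- The numerical radius `w(T) = sup {|⟨T h, h⟩| : ‖h‖ = 1}` of a bounded operator `T`.
The set is bounded above by `‖T‖`, and it is non-empty when the space is nonzero. -/
def numericalRadius {E : Type*} [NormedAddCommGroup E] [InnerProductSpace ℂ E]
    (T : E →L[ℂ] E) : ℝ :=
  sSup {r : ℝ | ∃ h : E, ‖h‖ = 1 ∧ r = ‖inner ℂ (T h) h‖}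

/-- A discrete group `G` is amenable if there is a left-invariant mean on `ℓ^∞(G)`: a positive
linear functional `m` with `m(1) = 1` and `m(g · f) = m(f)` for all `g` in `G`. -/
def IsAmenableGroup (G : Type*) [Group G] : Prop :=
  ∃ m : ℓ^∞(G, ℝ) →ₗ[ℝ] ℝ,
    m 1 = 1 ∧
    (∀ f : ℓ^∞(G, ℝ), (∀ h, 0 ≤ f h) → 0 ≤ m f) ∧
    ∀ (g : G) (f : ℓ^∞(G, ℝ)), m (leftTranslate ℝ ∞ g f) = m f

end

/-! For a unit vector f, |⟨Af, f⟩| is at most the α-weighted sum of the overlaps ∑ₓ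
|f(gᵢ⁻¹x)||f(x)|, each at most 1. As all αᵢ > 0, w(A) = ∑ αᵢ forces unit vectors whose overlaps all
tend to 1. Passing from f to p = |f|² and back by square roots, this amounts to probability vectors
on G almost invariant in ℓ¹ under every gᵢ (Reiter's condition). Such vectors, pushed from G to H
along an equivariant map, give means on ℓ^∞(H) whose ultrafilter limit is invariant. Conversely, if
almost invariant vectors did not exist, Hahn–Banach would yield a bounded function on H bounded
below by a positive constant and killed by every invariant mean. -/

open Filter Topology

/-! ### Overlap in ℓ² against distance in ℓ¹ -/

section Overlap

variable {ι : Type*} {a b : ι → ℝ} {c : ℝ}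

theorem overlap_le_one (ha : HasSum (fun x => a x ^ 2) 1) (hb : HasSum (fun x => b x ^ 2) 1)
    (hc : HasSum (fun x => a x * b x) c) : c ≤ 1 := by
  have h := ((ha.add hb).sub (hc.mul_left 2)).nonneg fun x => by
    nlinarith [sq_nonneg (a x - b x)]
  linarith

/-- If `a`, `b` are unit vectors of `ℓ²` with overlap `c`, then `a²` and `b²` are at `ℓ¹`-distance
at most `t (1 - c) + 2 / t` for every `t > 0`. -/
theorem summable_and_tsum_abs_sq_sub_sq_le (ha : HasSum (fun x => a x ^ 2) 1)
    (hb : HasSum (fun x => b x ^ 2) 1) (hc : HasSum (fun x => a x * b x) c) {t : ℝ} (ht : 0 < t) :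
    Summable (fun x => |a x ^ 2 - b x ^ 2|) ∧
      ∑' x, |a x ^ 2 - b x ^ 2| ≤ t * (1 - c) + 2 / t := by
  have hS : HasSum (fun x => t / 2 * (a x ^ 2 + b x ^ 2 - 2 * (a x * b x)) +
      1 / (2 * t) * (a x ^ 2 + b x ^ 2 + 2 * (a x * b x)))
      (t / 2 * (1 + 1 - 2 * c) + 1 / (2 * t) * (1 + 1 + 2 * c)) :=
    (((ha.add hb).sub (hc.mul_left 2)).mul_left _).add
      (((ha.add hb).add (hc.mul_left 2)).mul_left _)
  have hle : ∀ x, |a x ^ 2 - b x ^ 2| ≤ t / 2 * (a x ^ 2 + b x ^ 2 - 2 * (a x * b x)) +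
      1 / (2 * t) * (a x ^ 2 + b x ^ 2 + 2 * (a x * b x)) := by
    intro x
    -- Weighted AM–GM for the factors of a² - b² = (a - b)(a + b); s = ±1 is its sign.
    have key : ∀ s : ℝ, s ^ 2 = 1 → s * (a x ^ 2 - b x ^ 2) ≤
        t / 2 * (a x ^ 2 + b x ^ 2 - 2 * (a x * b x)) +
        1 / (2 * t) * (a x ^ 2 + b x ^ 2 + 2 * (a x * b x)) := by
      intro s hs
      have h0 : t / 2 * (a x ^ 2 + b x ^ 2 - 2 * (a x * b x)) +
          1 / (2 * t) * (a x ^ 2 + b x ^ 2 + 2 * (a x * b x)) - s * (a x ^ 2 - b x ^ 2) =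
          1 / (2 * t) * (t * (a x - b x) - s * (a x + b x)) ^ 2 +
            1 / (2 * t) * (1 - s ^ 2) * (a x + b x) ^ 2 := by
        field_simp
        ring
      have h1 : 0 ≤ 1 / (2 * t) * (t * (a x - b x) - s * (a x + b x)) ^ 2 := by positivity
      rw [hs, sub_self, mul_zero, zero_mul, add_zero] at h0
      linarith
    refine abs_le'.2 ⟨?_, ?_⟩
    · simpa using key 1 (by norm_num)
    · simpa using key (-1) (by norm_num)
  have hs : Summable (fun x => |a x ^ 2 - b x ^ 2|) :=
    hS.summable.of_nonneg_of_le (fun x => abs_nonneg _) hle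
  refine ⟨hs, (hasSum_le hle hs.hasSum hS).trans ?_⟩
  have h1 : c ≤ 1 := overlap_le_one ha hb hc
  have h2 : t / 2 * (1 + 1 - 2 * c) + 1 / (2 * t) * (1 + 1 + 2 * c) =
      t * (1 - c) + 2 / t - (1 - c) / t := by
    field_simp
    ring
  have h3 : 0 ≤ (1 - c) / t := div_nonneg (by linarith) ht.le
  linarith

end Overlap

/-! ### From maximal numerical radius to almost invariant vectors -/

section Regular

variable {G : Type*}

theorem hasSum_norm_sq (f : ℓ^2(G, ℂ)) : HasSum (fun x => ‖f x‖ ^ 2) (‖f‖ ^ 2) := by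
  simpa using lp.hasSum_norm (by norm_num : 0 < (2 : ℝ≥0∞).toReal) f

variable [Group G]

theorem hasSum_norm_sq_translate (g : G) (f : ℓ^2(G, ℂ)) :
    HasSum (fun x => ‖f (g⁻¹ * x)‖ ^ 2) (‖f‖ ^ 2) :=
  (Equiv.mulLeft g⁻¹).hasSum_iff.2 (hasSum_norm_sq f)

theorem summable_overlap (g : G) (f : ℓ^2(G, ℂ)) :
    Summable fun x => ‖f (g⁻¹ * x)‖ * ‖f x‖ := by
  refine ((hasSum_norm_sq_translate g f).add (hasSum_norm_sq f)).summable.of_nonneg_of_le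
    (fun x => by positivity) fun x => ?_
  nlinarith [sq_nonneg (‖f (g⁻¹ * x)‖ - ‖f x‖), sq_nonneg (‖f (g⁻¹ * x)‖ + ‖f x‖)]

theorem hasSum_inner_leftRegular (g : G) (f : ℓ^2(G, ℂ)) :
    HasSum (fun x => inner ℂ (f (g⁻¹ * x)) (f x)) (inner ℂ (leftRegular g f) f) :=
  lp.hasSum_inner (leftRegular g f) f

theorem norm_inner_leftRegular_le (g : G) (f : ℓ^2(G, ℂ)) :
    ‖inner ℂ (leftRegular g f) f‖ ≤ ∑' x, ‖f (g⁻¹ * x)‖ * ‖f x‖ := by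
  rw [← (hasSum_inner_leftRegular g f).tsum_eq]
  exact tsum_of_norm_bounded (summable_overlap g f).hasSum fun x => norm_inner_le_norm _ _

theorem overlap_translate_le_one (g : G) {f : ℓ^2(G, ℂ)} (hf : ‖f‖ = 1) :
    ∑' x, ‖f (g⁻¹ * x)‖ * ‖f x‖ ≤ 1 :=
  overlap_le_one (by simpa [hf] using hasSum_norm_sq_translate g f)
    (by simpa [hf] using hasSum_norm_sq f) (summable_overlap g f).hasSum

variable {n : ℕ} (g : Fin n → G) {α : Fin n → ℝ}

theorem inner_sum_leftRegular (f : ℓ^2(G, ℂ)) :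
    inner ℂ ((∑ i, (α i : ℂ) • leftRegular (g i)) f) f =
      ∑ i, (α i : ℂ) * inner ℂ (leftRegular (g i) f) f := by
  rw [sum_apply, sum_inner]
  refine Finset.sum_congr rfl fun i _ => ?_
  change inner ℂ ((α i : ℂ) • leftRegular (g i) f) f = _
  rw [inner_smul_left, Complex.conj_ofReal]

theorem norm_inner_sum_leftRegular_le (hα : ∀ i, 0 < α i) (f : ℓ^2(G, ℂ)) :
    ‖inner ℂ ((∑ i, (α i : ℂ) • leftRegular (g i)) f) f‖ ≤
      ∑ i, α i * ∑' x, ‖f ((g i)⁻¹ * x)‖ * ‖f x‖ := by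
  rw [inner_sum_leftRegular]
  refine (norm_sum_le _ _).trans (Finset.sum_le_sum fun i _ => ?_)
  rw [norm_mul, Complex.norm_real, Real.norm_of_nonneg (hα i).le]
  exact mul_le_mul_of_nonneg_left (norm_inner_leftRegular_le _ _) (hα i).le

theorem norm_inner_sum_leftRegular_le_sum (hα : ∀ i, 0 < α i) {f : ℓ^2(G, ℂ)} (hf : ‖f‖ = 1) :
    ‖inner ℂ ((∑ i, (α i : ℂ) • leftRegular (g i)) f) f‖ ≤ ∑ i, α i := by
  refine (norm_inner_sum_leftRegular_le g hα f).trans (Finset.sum_le_sum fun i _ => ?_)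
  exact mul_le_of_le_one_right (hα i).le (overlap_translate_le_one _ hf)

theorem numericalRange_norm_nonempty (T : ℓ^2(G, ℂ) →L[ℂ] ℓ^2(G, ℂ)) :
    {r : ℝ | ∃ h : ℓ^2(G, ℂ), ‖h‖ = 1 ∧ r = ‖inner ℂ (T h) h‖}.Nonempty := by
  classical
  refine ⟨_, lp.single 2 1 1, ?_, rfl⟩
  rw [lp.norm_single (by norm_num)]
  simp

/-- If the numerical radius is maximal there are unit vectors with overlap close to `1`. -/
theorem exists_overlap_ge (hα : ∀ i, 0 < α i)
    (hw : numericalRadius (∑ i, (α i : ℂ) • leftRegular (g i)) = ∑ i, α i) {ε : ℝ} (hε : 0 < ε) :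
    ∃ f : ℓ^2(G, ℂ), ‖f‖ = 1 ∧
      ∀ i, 1 - ε / α i ≤ ∑' x, ‖f ((g i)⁻¹ * x)‖ * ‖f x‖ := by
  obtain ⟨_, ⟨f, hf, rfl⟩, hlt⟩ :=
    exists_lt_of_lt_csSup (numericalRange_norm_nonempty (∑ i, (α i : ℂ) • leftRegular (g i)))
      (show ∑ i, α i - ε < _ by
        change _ < numericalRadius (∑ i, (α i : ℂ) • leftRegular (g i))
        linarith)
  refine ⟨f, hf, fun i => ?_⟩
  have h1 := hlt.le.trans (norm_inner_sum_leftRegular_le g hα f)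
  -- All deficits are nonnegative, so the total deficit, below ε, bounds each one.
  have h2 : α i * (1 - ∑' x, ‖f ((g i)⁻¹ * x)‖ * ‖f x‖) ≤
      ∑ j, α j * (1 - ∑' x, ‖f ((g j)⁻¹ * x)‖ * ‖f x‖) :=
    Finset.single_le_sum (f := fun j => α j * (1 - ∑' x, ‖f ((g j)⁻¹ * x)‖ * ‖f x‖))
      (fun j _ => mul_nonneg (hα j).le (sub_nonneg.2 (overlap_translate_le_one _ hf)))
      (Finset.mem_univ i)
  simp only [mul_sub, mul_one, Finset.sum_sub_distrib] at h2
  rw [sub_le_comm, le_div_iff₀ (hα i)]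
  linarith

/-- If `w(∑ αᵢ λ(gᵢ)) = ∑ αᵢ`, there are probability vectors on `G` which are almost invariant
under the `gᵢ`. -/
theorem exists_almost_invariant_of_numericalRadius_eq (hα : ∀ i, 0 < α i)
    (hw : numericalRadius (∑ i, (α i : ℂ) • leftRegular (g i)) = ∑ i, α i) (k : ℕ) :
    ∃ p : G → ℝ, (∀ x, 0 ≤ p x) ∧ HasSum p 1 ∧
      ∀ i, Summable (fun x => |p ((g i)⁻¹ * x) - p x|) ∧
        ∑' x, |p ((g i)⁻¹ * x) - p x| ≤ (1 / α i + 2) * (1 / ((k : ℝ) + 1)) := by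
  have hk : (0 : ℝ) < k + 1 := by positivity
  -- With ε = 1 / (k + 1)² and t = k + 1, both terms of t(1 - c) + 2/t are O(1 / (k + 1)).
  obtain ⟨f, hf, h⟩ := exists_overlap_ge g hα hw (ε := 1 / ((k : ℝ) + 1) ^ 2) (by positivity)
  refine ⟨fun x => ‖f x‖ ^ 2, fun x => by positivity, by simpa [hf] using hasSum_norm_sq f,
    fun i => ?_⟩
  obtain ⟨h1, h2⟩ := summable_and_tsum_abs_sq_sub_sq_le
    (by simpa [hf] using hasSum_norm_sq_translate (g i) f)
    (by simpa [hf] using hasSum_norm_sq f) (summable_overlap (g i) f).hasSum hk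
  refine ⟨h1, h2.trans ?_⟩
  have h3 : ((k : ℝ) + 1) * (1 - ∑' x, ‖f ((g i)⁻¹ * x)‖ * ‖f x‖) ≤
      ((k : ℝ) + 1) * (1 / ((k : ℝ) + 1) ^ 2 / α i) :=
    mul_le_mul_of_nonneg_left (by linarith [h i]) hk.le
  have h4 : ((k : ℝ) + 1) * (1 / ((k : ℝ) + 1) ^ 2 / α i) + 2 / ((k : ℝ) + 1) =
      (1 / α i + 2) * (1 / ((k : ℝ) + 1)) := by
    have := (hα i).ne'
    field_simp
  linarith

end Regular

/-! ### From almost invariant vectors to an invariant mean -/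

section Mean

variable {G : Type*} [Group G]

/-- For a subgroup `H` there is a left `H`-equivariant map `G → H`. -/
theorem exists_equivariant_map (H : Subgroup G) :
    ∃ c : G → H, ∀ (h : H) (x : G), c (h * x) = h * c x := by
  -- `c x` carries the chosen representative of the coset Hx to x; cancelling the representative
  -- gives equivariance.
  have hr : ∀ x : G, ∃ h : H, h • (Quotient.mk (MulAction.orbitRel H G) x).out = x := fun x =>
    MulAction.mem_orbit_iff.1 (MulAction.orbitRel_apply.1
      ((MulAction.orbitRel H G).symm (Quotient.mk_out (s := MulAction.orbitRel H G) x)))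
  choose c hc using hr
  refine ⟨c, fun h x => ?_⟩
  have hq : Quotient.mk (MulAction.orbitRel H G) ((h : G) * x) =
      Quotient.mk (MulAction.orbitRel H G) x :=
    Quotient.sound (MulAction.orbitRel_apply.2 ⟨h, rfl⟩)
  have h1 := hc (h * x)
  have h2 := hc x
  rw [hq] at h1
  simp only [Subgroup.smul_def, smul_eq_mul] at h1 h2
  apply Subtype.ext
  rw [Subgroup.coe_mul]
  apply mul_right_cancel (b := (Quotient.mk (MulAction.orbitRel H G) x).out)
  rw [h1, mul_assoc, h2]

/-- A limit along an ultrafilter of a sequence of uniformly bounded linear functionals. -/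
theorem exists_linearMap_tendsto_ultrafilter {E : Type*} [NormedAddCommGroup E] [NormedSpace ℝ E]
    (U : Ultrafilter ℕ) (φ : ℕ → E →ₗ[ℝ] ℝ) (hφ : ∀ k f, |φ k f| ≤ ‖f‖) :
    ∃ m : E →ₗ[ℝ] ℝ, ∀ f, Tendsto (fun k => φ k f) U (𝓝 (m f)) := by
  have hex : ∀ f, ∃ y, Tendsto (fun k => φ k f) U (𝓝 y) := by
    intro f
    obtain ⟨y, -, hy⟩ := (isCompact_Icc (a := -‖f‖) (b := ‖f‖)).ultrafilter_le_nhds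
      (U.map fun k => φ k f) (by
        rw [le_principal_iff]
        exact Eventually.of_forall (f := (U : Filter ℕ)) fun k => abs_le.1 (hφ k f))
    exact ⟨y, hy⟩
  choose m hm using hex
  refine ⟨⟨⟨m, fun f f' => ?_⟩, fun r f => ?_⟩, hm⟩
  · refine tendsto_nhds_unique (hm (f + f')) ?_
    simpa using (hm f).add (hm f')
  · refine tendsto_nhds_unique (hm (r • f)) ?_
    simpa using (hm f).const_mul r

/-- It is enough to check invariance on a generating set. -/
theorem leftInvariant_of_generators {H : Type*} [Group H] {S : Set H}
    (hS : Subgroup.closure S = ⊤) (m : ℓ^∞(H, ℝ) →ₗ[ℝ] ℝ)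
    (hm : ∀ s ∈ S, ∀ f, m (leftTranslate ℝ ∞ s f) = m f) (h : H) (f : ℓ^∞(H, ℝ)) :
    m (leftTranslate ℝ ∞ h f) = m f := by
  have hmul : ∀ (x y : H) (f : ℓ^∞(H, ℝ)),
      leftTranslate ℝ ∞ (x * y) f = leftTranslate ℝ ∞ x (leftTranslate ℝ ∞ y f) := by
    intro x y f
    ext z
    change f ((x * y)⁻¹ * z) = f (y⁻¹ * (x⁻¹ * z))
    rw [mul_inv_rev, mul_assoc]
  have hone : ∀ f : ℓ^∞(H, ℝ), leftTranslate ℝ ∞ (1 : H) f = f := by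
    intro f
    ext z
    change f (1⁻¹ * z) = f z
    rw [inv_one, one_mul]
  have hh : h ∈ Subgroup.closure S := hS ▸ Subgroup.mem_top h
  induction hh using Subgroup.closure_induction generalizing f with
  | mem s hs => exact hm s hs f
  | one => rw [hone]
  | mul x y _ _ hx hy => rw [hmul, hx, hy]
  | inv x _ hx => rw [← hx (leftTranslate ℝ ∞ x⁻¹ f), ← hmul, mul_inv_cancel, hone]

theorem summable_mul_of_bounded {X Y : Type*} {p : X → ℝ} (hp : Summable fun x => |p x|)
    (c : X → Y) (f : ℓ^∞(Y, ℝ)) : Summable fun x => p x * f (c x) := by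
  refine Summable.of_norm_bounded (hp.mul_right ‖f‖) fun x => ?_
  rw [norm_mul, Real.norm_eq_abs]
  exact mul_le_mul_of_nonneg_left (lp.norm_apply_le_norm ENNReal.top_ne_zero f _) (abs_nonneg _)

theorem abs_tsum_mul_le {X Y : Type*} {p : X → ℝ} (hp : Summable fun x => |p x|)
    (c : X → Y) (f : ℓ^∞(Y, ℝ)) : |∑' x, p x * f (c x)| ≤ (∑' x, |p x|) * ‖f‖ := by
  rw [← Real.norm_eq_abs]
  refine tsum_of_norm_bounded (hp.hasSum.mul_right ‖f‖) fun x => ?_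
  rw [norm_mul, Real.norm_eq_abs]
  exact mul_le_mul_of_nonneg_left (lp.norm_apply_le_norm ENNReal.top_ne_zero f _) (abs_nonneg _)

/-- The mean on `ℓ^∞(Y)` given by pushing forward a summable density along `c : X → Y`. -/
noncomputable def pushMean {X Y : Type*} {p : X → ℝ} (hp : Summable fun x => |p x|) (c : X → Y) :
    ℓ^∞(Y, ℝ) →ₗ[ℝ] ℝ where
  toFun f := ∑' x, p x * f (c x)
  map_add' f f' := by
    rw [← (summable_mul_of_bounded hp c f).tsum_add (summable_mul_of_bounded hp c f')]
    exact tsum_congr fun x => mul_add _ _ _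
  map_smul' r f := by
    rw [RingHom.id_apply, smul_eq_mul, ← tsum_mul_left]
    exact tsum_congr fun x => mul_left_comm _ _ _

/-- Equivariance of `c` turns almost invariance on G into almost invariance on H, and the limit
along a free ultrafilter makes it exact. -/
theorem isAmenableGroup_of_numericalRadius_eq {n : ℕ} (g : Fin n → G) {α : Fin n → ℝ}
    (hα : ∀ i, 0 < α i)
    (hw : numericalRadius (∑ i, (α i : ℂ) • leftRegular (g i)) = ∑ i, α i) :
    IsAmenableGroup (Subgroup.closure (Set.range g)) := by
  obtain ⟨c, hc⟩ := exists_equivariant_map (Subgroup.closure (Set.range g))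
  choose p hp0 hp1 hpg using exists_almost_invariant_of_numericalRadius_eq g hα hw
  have habs : ∀ k, (fun x => |p k x|) = p k := fun k => funext fun x => abs_of_nonneg (hp0 k x)
  have hp : ∀ k, Summable fun x => |p k x| := fun k => by
    rw [habs]
    exact (hp1 k).summable
  obtain ⟨m, hm⟩ := exists_linearMap_tendsto_ultrafilter (hyperfilter ℕ)
    (fun k => pushMean (hp k) c) (fun k f => by
      refine (abs_tsum_mul_le (hp k) c f).trans ?_
      rw [habs, (hp1 k).tsum_eq, one_mul])
  refine ⟨m, ?_, fun f hf => ?_, ?_⟩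
  · refine tendsto_nhds_unique (hm 1) (tendsto_const_nhds.congr fun k => ?_)
    change 1 = ∑' x, p k x * 1
    simp [(hp1 k).tsum_eq]
  · exact ge_of_tendsto' (hm f) fun k => tsum_nonneg fun x => mul_nonneg (hp0 k x) (hf _)
  · refine leftInvariant_of_generators
      (S := ((↑) : Subgroup.closure (Set.range g) → G) ⁻¹' Set.range g)
      Subgroup.closure_closure_coe_preimage m ?_
    rintro s ⟨i, hi⟩ f
    have hbound : ∀ k, |pushMean (hp k) c (leftTranslate ℝ ∞ s f) - pushMean (hp k) c f| ≤
        (1 / α i + 2) * (1 / ((k : ℝ) + 1)) * ‖f‖ := by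
      intro k
      obtain ⟨hs, hle⟩ := hpg k i
      have hs' : Summable fun x => |p k x - p k (s * x)| := by
        refine ((Equiv.mulLeft (s : G)).summable_iff.2 hs).congr fun x => ?_
        simp [← hi]
      have ht : ∑' x, |p k x - p k (s * x)| = ∑' x, |p k ((g i)⁻¹ * x) - p k x| := by
        rw [← (Equiv.mulLeft (s : G)).tsum_eq fun x => |p k ((g i)⁻¹ * x) - p k x|]
        exact tsum_congr fun x => by simp [← hi]
      have hp' : Summable fun x => |p k (s * x)| :=
        (Equiv.mulLeft (s : G)).summable_iff.2 (hp k)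
      have hs'' : Summable fun x => |p k (s * x) - p k x| :=
        hs'.congr fun x => abs_sub_comm _ _
      -- The substitution x ↦ s⁻¹x moves the translation from f to the density.
      have h1 : pushMean (hp k) c (leftTranslate ℝ ∞ s f) = ∑' x, p k (s * x) * f (c x) := by
        rw [← (Equiv.mulLeft (s : G)⁻¹).tsum_eq fun x => p k (s * x) * f (c x)]
        refine tsum_congr fun x => ?_
        change p k x * f (s⁻¹ * c x) = p k (s * ((s : G)⁻¹ * x)) * f (c ((s : G)⁻¹ * x))
        rw [mul_inv_cancel_left, ← Subgroup.coe_inv, hc]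
      have h2 : pushMean (hp k) c (leftTranslate ℝ ∞ s f) - pushMean (hp k) c f =
          ∑' x, (p k (s * x) - p k x) * f (c x) := by
        rw [h1]
        change _ - ∑' x, p k x * f (c x) = _
        rw [← (summable_mul_of_bounded hp' c f).tsum_sub (summable_mul_of_bounded (hp k) c f)]
        exact tsum_congr fun x => (sub_mul _ _ _).symm
      rw [h2]
      refine (abs_tsum_mul_le hs'' c f).trans ?_
      simp only [abs_sub_comm (p k (s * _))]
      rw [ht]
      exact mul_le_mul_of_nonneg_right hle (norm_nonneg f)
    have h1 : Tendsto (fun k => pushMean (hp k) c (leftTranslate ℝ ∞ s f) - pushMean (hp k) c f)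
        (hyperfilter ℕ) (𝓝 0) := by
      refine squeeze_zero_norm hbound ?_
      refine Tendsto.mono_left ?_ (Nat.hyperfilter_le_atTop)
      simpa using (tendsto_one_div_add_atTop_nhds_zero_nat (𝕜 := ℝ)).const_mul (1 / α i + 2)
        |>.mul_const ‖f‖
    exact sub_eq_zero.1 (tendsto_nhds_unique ((hm _).sub (hm f)) h1)

end Mean

/-! ### From an invariant mean to maximal numerical radius -/

section Reiter

variable {G : Type*}

/-- The probability vectors in `ℓ¹(G)`. -/
def probVectors (G : Type*) : Set ℓ^1(G, ℝ) := {p | (∀ x, 0 ≤ p x) ∧ HasSum p 1}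

theorem convex_probVectors : Convex ℝ (probVectors G) := by
  rintro p ⟨hp0, hp1⟩ q ⟨hq0, hq1⟩ a b ha hb hab
  refine ⟨fun x => add_nonneg (mul_nonneg ha (hp0 x)) (mul_nonneg hb (hq0 x)), ?_⟩
  have := (hp1.mul_left a).add (hq1.mul_left b)
  rwa [mul_one, mul_one, hab] at this

theorem single_mem_probVectors [DecidableEq G] (x : G) :
    (lp.single 1 x 1 : ℓ^1(G, ℝ)) ∈ probVectors G := by
  refine ⟨fun y => ?_, ?_⟩
  · rw [lp.single_apply]
    by_cases h : y = x
    · subst h; simp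
    · simp [h]
  · rw [lp.coeFn_single]
    exact hasSum_pi_single x 1

variable [Group G]

theorem leftTranslate_single [DecidableEq G] (p : ℝ≥0∞) (g x : G) (r : ℝ) :
    leftTranslate ℝ p g (lp.single p x r) = lp.single p (g * x) r := by
  ext y
  change (lp.single p x r : ℓ^p(G, ℝ)) (g⁻¹ * y) = _
  rw [lp.single_apply, lp.single_apply]
  simp only [Pi.single_apply, inv_mul_eq_iff_eq_mul]

/-- The displacement `p ↦ (gᵢ · p - p)ᵢ` on `ℓ¹(G)`. -/
noncomputable def displacement {n : ℕ} (g : Fin n → G) : ℓ^1(G, ℝ) →ₗ[ℝ] (Fin n → ℓ^1(G, ℝ)) :=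
  LinearMap.pi fun i => leftTranslate ℝ 1 (g i) - LinearMap.id

/-- The restriction to a subgroup, `ℓ^∞(G) → ℓ^∞(H)`. -/
noncomputable def restrictSubgroup (H : Subgroup G) : ℓ^∞(G, ℝ) →ₗ[ℝ] ℓ^∞(H, ℝ) where
  toFun f := ⟨fun h => f h, memℓp_infty (by
    refine (memℓp_infty_iff.1 f.2).mono ?_
    rintro _ ⟨h, rfl⟩
    exact ⟨h, rfl⟩)⟩
  map_add' _ _ := rfl
  map_smul' _ _ := rfl

/-- Day's argument: an amenable subgroup has almost invariant probability vectors. -/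
theorem zero_mem_closure_displacement {n : ℕ} (g : Fin n → G) {H : Subgroup G}
    (hg : ∀ i, g i ∈ H) (hH : IsAmenableGroup H) :
    (0 : Fin n → ℓ^1(G, ℝ)) ∈ closure (displacement g '' probVectors G) := by
  classical
  by_contra h0
  -- A separating functional satisfies φ > u > 0 on all displacements.
  obtain ⟨φ, u, hu, hφ⟩ := geometric_hahn_banach_point_closed
    ((convex_probVectors.is_linear_image (displacement g).isLinear).closure) isClosed_closure h0
  rw [map_zero] at hu
  obtain ⟨m, hm1, hmpos, hminv⟩ := hH
  -- The i-th component of φ, evaluated on point masses.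
  let F : Fin n → ℓ^∞(G, ℝ) := fun i =>
    ⟨fun x => φ (Pi.single i (lp.single 1 x 1)), memℓp_infty ⟨‖φ‖, by
      rintro _ ⟨x, rfl⟩
      refine (φ.le_opNorm _).trans ?_
      rw [Pi.norm_single, lp.norm_single (by norm_num)]
      simp⟩⟩
  let s : Fin n → H := fun i => ⟨g i, hg i⟩
  -- D(h) is φ of the displacement of the point mass at h, so D ≥ u on H; yet invariance gives m(D)
  -- = 0, contradicting m(D) ≥ u > 0.
  let D : ℓ^∞(H, ℝ) := ∑ i, (leftTranslate ℝ ∞ (s i)⁻¹ (restrictSubgroup H (F i)) -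
    restrictSubgroup H (F i))
  have hD0 : m D = 0 := by
    simp [D, map_sum, hminv]
  have hDpos : ∀ h : H, u ≤ D h := by
    intro h
    have h1 := hφ _ (subset_closure ⟨_, single_mem_probVectors (h : G), rfl⟩)
    have h2 : φ (displacement g (lp.single 1 (h : G) 1)) = D h := by
      have h3 : displacement g (lp.single 1 (h : G) 1) = ∑ i,
          (Pi.single i (lp.single 1 (g i * h) 1) - Pi.single i (lp.single 1 (h : G) 1) :
            Fin n → ℓ^1(G, ℝ)) := by
        simp only [← Pi.single_sub]
        rw [Finset.univ_sum_single]
        funext i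
        simp [displacement, leftTranslate_single]
      rw [h3, map_sum]
      simp only [D, lp.coeFn_sum, Finset.sum_apply, map_sub]
      refine Finset.sum_congr rfl fun i _ => ?_
      change _ = F i (((s i)⁻¹⁻¹ * h : H) : G) - F i h
      rw [inv_inv]
      rfl
    exact (h2 ▸ h1).le
  have h4 : 0 ≤ m (D - u • 1) := hmpos _ fun h => by
    have := hDpos h
    change 0 ≤ D h - u * 1
    linarith
  rw [map_sub, map_smul, hm1, hD0, smul_eq_mul] at h4
  linarith

theorem exists_almost_invariant_of_isAmenableGroup {n : ℕ} (g : Fin n → G)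
    (hH : IsAmenableGroup (Subgroup.closure (Set.range g))) {ε : ℝ} (hε : 0 < ε) :
    ∃ p : G → ℝ, (∀ x, 0 ≤ p x) ∧ HasSum p 1 ∧
      ∀ i, Summable (fun x => |p ((g i)⁻¹ * x) - p x|) ∧
        ∑' x, |p ((g i)⁻¹ * x) - p x| ≤ ε := by
  obtain ⟨_, ⟨p, hp, rfl⟩, hlt⟩ :=
    Metric.mem_closure_iff.1 (zero_mem_closure_displacement g
      (fun i => Subgroup.subset_closure (Set.mem_range_self i)) hH) ε hε
  rw [dist_zero_left] at hlt
  refine ⟨p, hp.1, hp.2, fun i => ?_⟩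
  have h1 : HasSum (fun x => |p ((g i)⁻¹ * x) - p x|) ‖displacement g p i‖ := by
    have := lp.hasSum_norm (by norm_num : 0 < (1 : ℝ≥0∞).toReal) (displacement g p i)
    simp only [ENNReal.toReal_one, Real.rpow_one] at this
    exact this
  refine ⟨h1.summable, ?_⟩
  rw [h1.tsum_eq]
  exact (norm_le_pi_norm _ i).trans hlt.le

/-- Square roots of almost invariant probability vectors are almost invariant unit vectors. -/
theorem exists_unit_vector_inner_leftRegular {n : ℕ} (g : Fin n → G)
    (hH : IsAmenableGroup (Subgroup.closure (Set.range g))) {ε : ℝ} (hε : 0 < ε) :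
    ∃ f : ℓ^2(G, ℂ), ‖f‖ = 1 ∧ ∀ i, 1 - ε ≤ (inner ℂ (leftRegular (g i) f) f).re := by
  obtain ⟨p, hp0, hp1, hp⟩ := exists_almost_invariant_of_isAmenableGroup g hH hε
  have hsq : ∀ x, ‖((√(p x) : ℝ) : ℂ)‖ ^ 2 = p x := fun x => by
    rw [Complex.norm_real, Real.norm_eq_abs, sq_abs, Real.sq_sqrt (hp0 x)]
  let f : ℓ^2(G, ℂ) := ⟨fun x => ((√(p x) : ℝ) : ℂ), memℓp_gen (by
    simpa only [ENNReal.toReal_ofNat, Real.rpow_ofNat, hsq] using hp1.summable)⟩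
  have hf : ‖f‖ = 1 := by
    have h1 : HasSum p (‖f‖ ^ 2) := by simpa only [f, hsq] using hasSum_norm_sq f
    have h2 := h1.unique hp1
    nlinarith [norm_nonneg f]
  refine ⟨f, hf, fun i => ?_⟩
  have h1 := Complex.hasSum_re (hasSum_inner_leftRegular (g i) f)
  -- Pointwise, √a √b ≥ min(a, b) = (a + b - |a - b|) / 2.
  have h2 : HasSum (fun x => (1 / 2 : ℝ) *
      (p ((g i)⁻¹ * x) + p x - |p ((g i)⁻¹ * x) - p x|))
      ((1 / 2 : ℝ) * (1 + 1 - ∑' x, |p ((g i)⁻¹ * x) - p x|)) :=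
    ((((Equiv.mulLeft (g i)⁻¹).hasSum_iff.2 hp1).add hp1).sub (hp i).1.hasSum).mul_left _
  have h3 := hasSum_le (fun x => ?_) h2 h1
  · linarith [(hp i).2]
  · change _ ≤ (inner ℂ ((√(p ((g i)⁻¹ * x)) : ℝ) : ℂ) ((√(p x) : ℝ) : ℂ)).re
    have ha := Real.sqrt_nonneg (p ((g i)⁻¹ * x))
    have hb := Real.sqrt_nonneg (p x)
    have ha2 := Real.sq_sqrt (hp0 ((g i)⁻¹ * x))
    have hb2 := Real.sq_sqrt (hp0 x)
    have h4 : (inner ℂ ((√(p ((g i)⁻¹ * x)) : ℝ) : ℂ) ((√(p x) : ℝ) : ℂ)).re =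
        √(p ((g i)⁻¹ * x)) * √(p x) := by
      simp [mul_comm]
    rw [h4]
    rcases le_total (√(p ((g i)⁻¹ * x))) (√(p x)) with h | h
    · have := neg_abs_le (p ((g i)⁻¹ * x) - p x)
      nlinarith
    · have := le_abs_self (p ((g i)⁻¹ * x) - p x)
      nlinarith

theorem numericalRadius_eq_of_isAmenableGroup {n : ℕ} (g : Fin n → G) {α : Fin n → ℝ}
    (hα : ∀ i, 0 < α i) (hH : IsAmenableGroup (Subgroup.closure (Set.range g))) :
    numericalRadius (∑ i, (α i : ℂ) • leftRegular (g i)) = ∑ i, α i := by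
  have hub : ∀ r ∈ {r : ℝ | ∃ h : ℓ^2(G, ℂ), ‖h‖ = 1 ∧
      r = ‖inner ℂ ((∑ i, (α i : ℂ) • leftRegular (g i)) h) h‖}, r ≤ ∑ i, α i := by
    rintro _ ⟨f, hf, rfl⟩
    exact norm_inner_sum_leftRegular_le_sum g hα hf
  refine le_antisymm (csSup_le (numericalRange_norm_nonempty _) hub) ?_
  have hS : 0 ≤ ∑ i, α i := Finset.sum_nonneg fun i _ => (hα i).le
  refine le_of_forall_pos_le_add fun ε hε => ?_
  -- The added 1 keeps the denominator positive when n = 0.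
  obtain ⟨f, hf, h⟩ := exists_unit_vector_inner_leftRegular g hH
    (ε := ε / (∑ i, α i + 1)) (by positivity)
  have h1 : ‖inner ℂ ((∑ i, (α i : ℂ) • leftRegular (g i)) f) f‖ ≤
      numericalRadius (∑ i, (α i : ℂ) • leftRegular (g i)) := le_csSup ⟨_, hub⟩ ⟨f, hf, rfl⟩
  have h2 : ∑ i, α i * (1 - ε / (∑ i, α i + 1)) ≤
      (inner ℂ ((∑ i, (α i : ℂ) • leftRegular (g i)) f) f).re := by
    rw [inner_sum_leftRegular, Complex.re_sum]
    refine Finset.sum_le_sum fun i _ => ?_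
    rw [Complex.re_ofReal_mul]
    exact mul_le_mul_of_nonneg_left (h i) (hα i).le
  rw [← Finset.sum_mul] at h2
  have h3 := h2.trans ((Complex.re_le_norm _).trans h1)
  have h4 : (∑ i, α i) * (ε / (∑ i, α i + 1)) ≤ ε := by
    rw [mul_div_assoc', div_le_iff₀ (by positivity)]
    nlinarith
  linarith

end Reiter

/-- Let `g₁, …, gₙ` be elements of a discrete group `G`, let `H` be the subgroup they generate,
and let `αᵢ > 0`. Then `w(∑ αᵢ λ(gᵢ)) = ∑ αᵢ` if and only if `H` is amenable. -/
theorem mainTheorem5 {G : Type*} [Group G] (n : ℕ) (g : Fin n → G) (α : Fin n → ℝ)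
    (hα : ∀ i, 0 < α i) :
    numericalRadius (∑ i, (α i : ℂ) • leftRegular (g i)) = ∑ i, α i ↔
      IsAmenableGroup (Subgroup.closure (Set.range g)) :=
  ⟨isAmenableGroup_of_numericalRadius_eq g hα, numericalRadius_eq_of_isAmenableGroup g hα⟩
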